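/- Let $1 \le d \le n-1$ be integers. A subset $M \subseteq \mathbb{R}^n$ is a *$d$-submanifold of class $C^r$* if every point of $M$ lies in the image of a *local parametrization of class $C^r$*: a $C^r$ immersion $f : U \to \mathbb{R}^n$ of an open set $U \subseteq \mathbb{R}^d$ that is a homeomorphism onto a relatively open subset of $M$. For $p = f(x)$, let $T_pM$ be the image of the differential of $f$ at $x$ and, if $M$ is of class $C^2$ and $f$ is a local parametrization of class $C^2$, let $T_p^2M$ be the linear span of all first and second partial derivatives of $f$ at $x$; neither depends on $f$. Let $M$ be a $d$-submanifold of $\mathbb{R}^n$ of class $C^1$ and let $\varphi : M \to \mathbb{P}^{n-1}$ be a $C^1$ map into the space of lines through the origin of $\mathbb{R}^n$. It defines the $C^1$ line bundle $\mathscr{L} = \{(p,u) \in \mathbb{R}^n \times \mathbb{R}^n : p \in M,\ u \in \varphi(p)\}$ over $M$. Let $\Delta_*(x,y) = x+y$ be the codiagonal morphism $\mathbb{R}^n \oplus \mathbb{R}^n \to \mathbb{R}^n$, so that $$\Delta_*\mathscr{L} = \bigcup_{p\in M} (p + \varphi(p)).$$ The bundle $\mathscr{L}$ is *tangent to $M$*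 if $\varphi(p) \subseteq T_pM$ for all $p \in M$. In that case $M$ is foliated by the integral curves of $\mathscr{L}$, which are of class $C^2$, and $\mathscr{L}$ is *osculating to $M$ at $p$* if $T^2_p\gamma \subseteq T_pM$, where $\gamma$ is the leaf through $p$; it is *osculating to $M$* if it is so at every $p \in M$. Here $T^2_p\gamma$ is computed on an embedded open piece of the leaf around $p$, that is, on a connected $1$-submanifold $N \subseteq M$ of class $C^2$ with $p \in N$ and $T_qN = \varphi(q)$ for all $q \in N$. The bundle $\mathscr{L}$ is *semi-generic* if it is not tangent to $M$, or it is tangent but not osculating to $M$. **Theorem.** If $\mathscr{L}$ is semi-generic, then $\mathcal{L}^{d+1}(\Delta_*\mathscr{L}) > 0$, where $\mathcal{L}^{d+1}$ denotes the $(d+1)$-dimensional (Hausdorff) measure on $\mathbb{R}^n$. Moreover, if $M$ is a hypersurface (that is, $d = n-1$), then $\Delta_*\mathscr{L}$ has non-empty interior. -/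

import Mathlib

open MeasureTheory
open scoped LinearAlgebra.Projectivization

noncomputable section

namespace EmbeddedBundle

/-- Euclidean space of dimension `n`. -/
abbrev Euc (n : ℕ) : Type := EuclideanSpace ℝ (Fin n)

/-- `f`, restricted to the open set `U` of `ℝ^d`, is a local parametrization of class `C^r` of
the subset `M` of `ℝ^n`: an immersion of class `C^r` that is a homeomorphism of `U` onto a
relatively open subset of `M`. -/
structure IsLocalParam {d n : ℕ} (r : WithTop ℕ∞) (M : Set (Euc n))
    (U : Set (Euc d)) (f : Euc d → Euc n) : Prop where
  isOpen : IsOpen U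
  contDiffOn : ContDiffOn ℝ r f U
  immersion : ∀ x ∈ U, Function.Injective (fderiv ℝ f x)
  isEmbedding : Topology.IsEmbedding (U.domRestrict f)
  image_open : ∃ V : Set (Euc n), IsOpen V ∧ f '' U = M ∩ V

/-- `M` is a `d`-dimensional submanifold of `ℝ^n` of class `C^r` (without boundary). -/
def IsSubmanifold {n : ℕ} (r : WithTop ℕ∞) (d : ℕ) (M : Set (Euc n)) : Prop :=
  ∀ p ∈ M, ∃ (U : Set (Euc d)) (f : Euc d → Euc n), IsLocalParam r M U f ∧ p ∈ f '' U

/-- The tangent space `T_p M` of a `d`-submanifold of class `C^1`: the image of the differential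
of a local parametrization around `p`. All local parametrizations have the same image, so the
span over all of them is that image. -/
def tangentSpace {n : ℕ} (d : ℕ) (M : Set (Euc n)) (p : Euc n) : Submodule ℝ (Euc n) :=
  Submodule.span ℝ {v | ∃ (U : Set (Euc d)) (f : Euc d → Euc n) (x : Euc d),
    IsLocalParam 1 M U f ∧ x ∈ U ∧ f x = p ∧ ∃ a : Euc d, v = fderiv ℝ f x a}

/-- The second osculating space `T_p^2 M` of a `d`-submanifold of class `C^2`: the span of all
first and second partial derivatives at `p` of a local parametrization. All local
parametrizations give the same span. -/
def secondOsculatingSpace {n : ℕ} (d : ℕ) (M : Set (Euc n)) (p : Euc n) :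
    Submodule ℝ (Euc n) :=
  Submodule.span ℝ {v | ∃ (U : Set (Euc d)) (f : Euc d → Euc n) (x : Euc d),
    IsLocalParam 2 M U f ∧ x ∈ U ∧ f x = p ∧
      ((∃ a : Euc d, v = fderiv ℝ f x a) ∨
        ∃ a b : Euc d, v = fderiv ℝ (fderiv ℝ f) x a b)}

/-- The map `φ : M → ℙ^{n-1}` on a `d`-submanifold `M` of `ℝ^n` is of class `C^1`, i.e. it
defines a `C^1` line bundle over `M`: around every point of `M` there are a local parametrization
`f : U → M` and a nowhere vanishing `C^1` map `X : U → ℝ^n` such that `X x` spans the line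
`φ (f x)`, for all `x` in `U`. -/
def IsC1LineBundle {n : ℕ} (d : ℕ) {M : Set (Euc n)} (φ : M → ℙ ℝ (Euc n)) : Prop :=
  ∀ p ∈ M, ∃ (U : Set (Euc d)) (f X : Euc d → Euc n),
    IsLocalParam 1 M U f ∧ p ∈ f '' U ∧ ContDiffOn ℝ 1 X U ∧
      ∀ x ∈ U, ∃ (hM : f x ∈ M) (hX : X x ≠ 0),
        φ ⟨f x, hM⟩ = Projectivization.mk ℝ (X x) hX

/-- The total space `{(p, u) | p ∈ M, u ∈ φ p}` of the line bundle defined by `φ`, embedded in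
`ℝ^n × ℝ^n`. -/
def totalSpace {n : ℕ} {M : Set (Euc n)} (φ : M → ℙ ℝ (Euc n)) : Set (Euc n × Euc n) :=
  {z | ∃ p : M, z.1 = p ∧ z.2 ∈ (φ p).submodule}

/-- The codiagonal morphism `ℝ^n ⊕ ℝ^n → ℝ^n`, `(x, y) ↦ x + y`. -/
def codiagonal (n : ℕ) : Euc n × Euc n →ₗ[ℝ] Euc n :=
  LinearMap.coprod LinearMap.id LinearMap.id

/-- The line bundle defined by `φ` is tangent to `M` (it is a line distribution on `M`). -/
def IsTangent {n : ℕ} (d : ℕ) {M : Set (Euc n)} (φ : M → ℙ ℝ (Euc n)) : Prop :=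
  ∀ p : M, (φ p).submodule ≤ tangentSpace d M p

/-- `N` is an open piece of a leaf of the foliation defined by the line distribution `φ`: a
connected `1`-submanifold of class `C^2` contained in `M` whose tangent line at each of its points
is the line of the distribution. (A whole leaf is only immersed, and may accumulate on itself, but
each of its points lies on such a piece, and any two pieces containing a point agree near it.) -/
structure IsLeafPiece {n : ℕ} {M : Set (Euc n)} (φ : M → ℙ ℝ (Euc n)) (N : Set (Euc n)) :
    Prop where
  subset : N ⊆ M
  isConnected : IsConnected N
  isSubmanifold : IsSubmanifold 2 1 N
  tangent : ∀ (q : Euc n) (hq : q ∈ N), tangentSpace 1 N q = (φ ⟨q, subset hq⟩).submodule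

/-- The line distribution `φ` is osculating to `M` at `p`: the second osculating space at `p` of
the leaf through `p` is contained in the tangent space of `M` at `p`. -/
def OsculatesAt {n : ℕ} (d : ℕ) {M : Set (Euc n)} (φ : M → ℙ ℝ (Euc n)) (p : M) : Prop :=
  ∀ N : Set (Euc n), IsLeafPiece φ N → (p : Euc n) ∈ N →
    secondOsculatingSpace 1 N p ≤ tangentSpace d M p

/-- The line distribution `φ` is osculating to `M`: it is so at all points of `M`. -/
def Osculates {n : ℕ} (d : ℕ) {M : Set (Euc n)} (φ : M → ℙ ℝ (Euc n)) : Prop :=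
  ∀ p : M, OsculatesAt d φ p

/-- A line bundle over `M` is semi-generic if it is not tangent to `M`, or it is tangent but not
osculating to `M`. -/
def IsSemiGeneric {n : ℕ} (d : ℕ) {M : Set (Euc n)} (φ : M → ℙ ℝ (Euc n)) : Prop :=
  ¬ IsTangent d φ ∨ (IsTangent d φ ∧ ¬ Osculates d φ)

end EmbeddedBundle

end

/-!
The set `Δ_* 𝓛` contains the image of `F (x, t) = f x + t • X x`, for `f` a local parametrization
of `M` and `X` a local `C^1` section spanning `φ`. As soon as the differential of `F`, which is
`(v, s) ↦ Df v + t • DX v + s • X x`, is injective at one point `(x, t)`, a linear left inverse of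
it maps the image of `F` onto a neighbourhood in `ℝ^{d+1}`; linear maps are Lipschitz, so the
image has positive `(d+1)`-dimensional Hausdorff measure
(`hausdorffMeasure_pos_of_injective_fderiv`). When `d + 1 = n` the differential is bijective
and the image contains an open set.

If `X x` is not tangent to `M`, then `t = 0` works. If the bundle is tangent, write `X x = Df ξ`.
The shear `v ↦ v - s ξ` turns the differential into `(v, s) ↦ (Df + t • DX) v - s t • DX ξ`, so
that for small `t ≠ 0` it is injective once `DX ξ` is not tangent to `M`
(`exists_injective_pencil`). Finally `DX ξ` is the only part of the second derivative of a leaf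
that may leave the tangent space: a parametrization `γ` of a leaf lifts through `f` to a
differentiable map `h` (`IsLocalParam.exists_lift`), its partial derivatives are multiples
`c • X ∘ h`, and differentiating gives a combination of `X x` and `DX ξ`
(`IsLeafPiece.second_derivative_mem`). If `DX ξ` were tangent at every point, the bundle would be
osculating. Thus only given leaves are used, and neither their existence nor their uniqueness.
-/

open Set Filter Topology

namespace EmbeddedBundle

/-! ### Linear algebra -/

section Linear

variable {E F : Type*} [NormedAddCommGroup E] [NormedSpace ℝ E]
  [NormedAddCommGroup F] [NormedSpace ℝ F]

lemma exists_continuous_leftInverse [FiniteDimensional ℝ F] (A : E →L[ℝ] F)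
    (hA : Function.Injective A) : ∃ P : F →L[ℝ] E, ∀ v, P (A v) = v := by
  obtain ⟨g, hg⟩ := LinearMap.exists_leftInverse_of_injective (A : E →ₗ[ℝ] F)
    (LinearMap.ker_eq_bot.2 hA)
  exact ⟨LinearMap.toContinuousLinearMap g, fun v => LinearMap.congr_fun hg v⟩

lemma injective_coprod_toSpanSingleton {A : E →L[ℝ] F} (hA : Function.Injective A) {y : F}
    (hy : ∀ v, A v ≠ y) :
    Function.Injective (A.coprod (ContinuousLinearMap.toSpanSingleton ℝ y)) := by
  rw [injective_iff_map_eq_zero]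
  rintro ⟨v, s⟩ h
  replace h : A v + s • y = 0 := by simpa using h
  have hs : s = 0 := by
    by_contra hs
    refine hy (-s⁻¹ • v) ?_
    rw [map_smul, eq_neg_of_add_eq_zero_left h, smul_neg, neg_smul, neg_neg, smul_smul,
      inv_mul_cancel₀ hs, one_smul]
  subst hs
  have hv : v = 0 := hA (by simpa using h)
  simp [hv]

/-- If `A` is injective and `B ξ` is not in its range, some member of the pencil `A + t • B` is
injective with range not containing `A ξ`. -/
lemma exists_injective_pencil [FiniteDimensional ℝ E] (A B : E →L[ℝ] F) (hA : Function.Injective A) (ξ : E)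
    (hξ : ∀ v, A v ≠ B ξ) :
    ∃ t : ℝ, Function.Injective
      ((A + t • B).coprod (ContinuousLinearMap.toSpanSingleton ℝ (A ξ))) := by
  let S : ℝ → (E × ℝ →L[ℝ] F) := fun t =>
    A.coprod (ContinuousLinearMap.toSpanSingleton ℝ (B ξ)) +
      t • B.comp (ContinuousLinearMap.fst ℝ E ℝ)
  have hS : Continuous S := by fun_prop
  have hS0 : Function.Injective (S 0) := by
    simpa [S] using injective_coprod_toSpanSingleton hA hξ
  have hev : ∀ᶠ t in 𝓝 (0 : ℝ), Function.Injective (S t) :=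
    hS.continuousAt.eventually
      (ContinuousLinearMap.isOpen_injective.mem_nhds hS0)
  obtain ⟨t, htS, ht⟩ : ∃ t : ℝ, Function.Injective (S t) ∧ t ≠ 0 :=
    ((hev.filter_mono nhdsWithin_le_nhds).and
      (self_mem_nhdsWithin : ({0}ᶜ : Set ℝ) ∈ 𝓝[≠] (0 : ℝ))).exists
  refine ⟨t, ?_⟩
  rw [injective_iff_map_eq_zero] at htS ⊢
  rintro ⟨v, s⟩ h
  replace h : A v + t • B v + s • A ξ = 0 := by simpa using h
  -- the shear `(v, s) ↦ (v + s • ξ, -(s * t))` carries the pencil to `S t`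
  have key := htS (v + s • ξ, -(s * t)) (by
    simp only [S, add_apply, ContinuousLinearMap.coprod_apply,
      ContinuousLinearMap.toSpanSingleton_apply, smul_apply,
      ContinuousLinearMap.comp_apply, ContinuousLinearMap.coe_fst', map_add, map_smul]
    rw [← h]
    module)
  obtain ⟨h1, h2⟩ := Prod.mk.inj key
  have hs : s = 0 := by simpa [ht] using h2
  subst hs
  simpa using h1

end Linear

/-! ### Images of maps with injective differential -/

lemma hausdorffMeasure_pos_of_injective_fderiv {E : Type*} [NormedAddCommGroup E]
    [NormedSpace ℝ E] [FiniteDimensional ℝ E] {n m : ℕ} (hm : Module.finrank ℝ E = m)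
    {F : E → Euc n} {L : E →L[ℝ] Euc n} {z : E} (hF : HasStrictFDerivAt F L z)
    (hL : Function.Injective L) {s : Set E} (hs : s ∈ 𝓝 z) :
    0 < μH[(m : ℝ)] (F '' s) := by
  obtain ⟨P, hP⟩ := exists_continuous_leftInverse L hL
  let e : E ≃L[ℝ] (Fin m → ℝ) := ContinuousLinearEquiv.ofFinrankEq (by simp [hm])
  let Q : Euc n →L[ℝ] (Fin m → ℝ) := (e : E →L[ℝ] (Fin m → ℝ)).comp P
  have hQF : HasStrictFDerivAt (Q ∘ F) (e : E →L[ℝ] (Fin m → ℝ)) z := by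
    have h := Q.hasStrictFDerivAt.comp z hF
    rwa [show Q.comp L = (e : E →L[ℝ] (Fin m → ℝ)) by ext v; simp [Q, hP]] at h
  have hmem : Q '' (F '' s) ∈ 𝓝 ((Q ∘ F) z) := by
    rw [← hQF.map_nhds_eq_of_equiv, ← image_comp]
    exact image_mem_map hs
  have hpos : 0 < μH[(m : ℝ)] (Q '' (F '' s)) := by
    have h := hausdorffMeasure_pi_real (ι := Fin m)
    rw [Fintype.card_fin] at h
    rw [h]
    exact Measure.measure_pos_of_mem_nhds _ hmem
  refine pos_iff_ne_zero.2 fun h0 => hpos.ne' ?_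
  have hle := Q.lipschitz.hausdorffMeasure_image_le (Nat.cast_nonneg m) (F '' s)
  rwa [h0, mul_zero, nonpos_iff_eq_zero] at hle

lemma interior_image_nonempty_of_injective_fderiv {E : Type*} [NormedAddCommGroup E]
    [NormedSpace ℝ E] [FiniteDimensional ℝ E] {n : ℕ} (hn : Module.finrank ℝ E = n)
    {F : E → Euc n} {L : E →L[ℝ] Euc n} {z : E} (hF : HasStrictFDerivAt F L z)
    (hL : Function.Injective L) {s : Set E} (hs : s ∈ 𝓝 z) :
    (interior (F '' s)).Nonempty := by
  have := FiniteDimensional.complete ℝ E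
  have hsurj : Function.Surjective (L : E →ₗ[ℝ] Euc n) :=
    (LinearMap.injective_iff_surjective_of_finrank_eq_finrank (by simp [hn])).1 hL
  refine ⟨F z, mem_interior_iff_mem_nhds.2 ?_⟩
  rw [← hF.map_nhds_eq_of_surj (LinearMap.range_eq_top.2 hsurj)]
  exact image_mem_map hs

/-! ### Lifting maps through a local parametrization -/

variable {n d k : ℕ}

/-- A differentiable map into `M` lifts differentiably through a local parametrization of class
`C^1`: near the base point the lift is a `C^1` local left inverse of `f` composed with the map. -/
lemma IsLocalParam.exists_lift {M : Set (Euc n)} {U : Set (Euc d)} {f : Euc d → Euc n}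
    (hf : IsLocalParam 1 M U f) {W : Set (Euc k)} (hW : IsOpen W) {g : Euc k → Euc n} {w : Euc k}
    (hg : DifferentiableAt ℝ g w) (hgM : MapsTo g W M) (hw : w ∈ W) {x : Euc d} (hx : x ∈ U)
    (hgf : g w = f x) :
    ∃ h : Euc k → Euc d, h w = x ∧ DifferentiableAt ℝ h w ∧
      ∀ᶠ s in 𝓝 w, h s ∈ U ∧ f (h s) = g s := by
  obtain ⟨V, hV, hfV⟩ := hf.image_open
  have hex : ∀ s, ∃ y : U, g s ∈ f '' U → f y = g s := by
    intro s
    by_cases hs : g s ∈ f '' U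
    · obtain ⟨y, hy, hys⟩ := hs
      exact ⟨⟨y, hy⟩, fun _ => hys⟩
    · exact ⟨⟨x, hx⟩, fun h => absurd h hs⟩
  choose h hh using hex
  have hev : ∀ᶠ s in 𝓝 w, f (h s) = g s := by
    have hwV : g w ∈ V := by
      rw [hgf]
      exact (hfV.subset (mem_image_of_mem f hx)).2
    filter_upwards [hW.mem_nhds hw, hg.continuousAt.eventually (hV.mem_nhds hwV)] with s hs hsV
    exact hh s (hfV ▸ ⟨hgM hs, hsV⟩)
  have hhw : h w = ⟨x, hx⟩ := by
    apply hf.isEmbedding.injective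
    simpa [hgf] using hev.self_of_nhds
  have hcont : Tendsto h (𝓝 w) (𝓝 ⟨x, hx⟩) := by
    rw [hf.isEmbedding.isInducing.tendsto_nhds_iff]
    have : Tendsto g (𝓝 w) (𝓝 (f x)) := hgf ▸ hg.continuousAt.tendsto
    exact this.congr' (hev.mono fun s hs => hs.symm)
  have hcont' : Tendsto (fun s => (h s : Euc d)) (𝓝 w) (𝓝 x) :=
    (continuous_subtype_val.tendsto _).comp hcont
  obtain ⟨P, hP⟩ := exists_continuous_leftInverse _ (hf.immersion x hx)
  have hst : HasStrictFDerivAt f (fderiv ℝ f x) x :=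
    (hf.contDiffOn.contDiffAt (hf.isOpen.mem_nhds hx)).hasStrictFDerivAt one_ne_zero
  have hPf : HasStrictFDerivAt (P ∘ f) (ContinuousLinearEquiv.refl ℝ (Euc d) :
      Euc d →L[ℝ] Euc d) x := by
    have h := P.hasStrictFDerivAt.comp x hst
    rwa [show P.comp (fderiv ℝ f x) = (ContinuousLinearEquiv.refl ℝ (Euc d) :
      Euc d →L[ℝ] Euc d) by ext1 v; simp [hP]] at h
  refine ⟨fun s => h s, by simp [hhw], ?_, hev.mono fun s hs => ⟨(h s).2, hs⟩⟩
  have hinv : DifferentiableAt ℝ (hPf.localInverse (P ∘ f) _ x) (P (g w)) := by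
    rw [hgf]
    exact hPf.to_localInverse.hasFDerivAt.differentiableAt
  have hcomp : DifferentiableAt ℝ (fun s => hPf.localInverse (P ∘ f) _ x (P (g s))) w :=
    hinv.comp (f := fun s => P (g s)) w (P.differentiableAt.comp w hg)
  refine hcomp.congr_of_eventuallyEq ?_
  filter_upwards [hev, hcont'.eventually hPf.eventually_left_inverse] with s hs hs'
  rw [← hs]
  exact hs'.symm

lemma IsLocalParam.differentiableAt {r : WithTop ℕ∞} (hr : 1 ≤ r) {M : Set (Euc n)}
    {U : Set (Euc d)} {f : Euc d → Euc n} (hf : IsLocalParam r M U f) {x : Euc d} (hx : x ∈ U) :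
    DifferentiableAt ℝ f x :=
  (hf.contDiffOn.contDiffAt (hf.isOpen.mem_nhds hx)).differentiableAt (by
    rintro rfl
    simp at hr)

lemma IsLocalParam.mapsTo {r : WithTop ℕ∞} {M : Set (Euc n)}
    {U : Set (Euc d)} {f : Euc d → Euc n} (hf : IsLocalParam r M U f) : MapsTo f U M := by
  obtain ⟨V, -, hV⟩ := hf.image_open
  exact fun x hx => (hV.subset (mem_image_of_mem f hx)).1

lemma IsLocalParam.of_le {r s : WithTop ℕ∞} {M : Set (Euc n)}
    {U : Set (Euc d)} {f : Euc d → Euc n} (hf : IsLocalParam r M U f) (h : s ≤ r) :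
    IsLocalParam s M U f :=
  { hf with contDiffOn := hf.contDiffOn.of_le h }

lemma IsLocalParam.fderiv_mem_tangentSpace {M : Set (Euc n)} {U : Set (Euc d)}
    {f : Euc d → Euc n} (hf : IsLocalParam 1 M U f) {x : Euc d} (hx : x ∈ U) (a : Euc d) :
    fderiv ℝ f x a ∈ tangentSpace d M (f x) :=
  Submodule.subset_span ⟨U, f, x, hf, hx, rfl, a, rfl⟩

/-- The tangent space is the image of the differential of any one local parametrization. -/
lemma IsLocalParam.exists_fderiv_eq {M : Set (Euc n)} {U : Set (Euc d)}
    {f : Euc d → Euc n} (hf : IsLocalParam 1 M U f) {x : Euc d} (hx : x ∈ U) {v : Euc n}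
    (hv : v ∈ tangentSpace d M (f x)) : ∃ a, fderiv ℝ f x a = v := by
  suffices h : tangentSpace d M (f x) ≤ LinearMap.range (fderiv ℝ f x : Euc d →ₗ[ℝ] Euc n) from
    h hv
  refine Submodule.span_le.2 ?_
  rintro _ ⟨W, g, w, hg, hw, hgw, a, rfl⟩
  obtain ⟨h, rfl, hdiff, hev⟩ :=
    hf.exists_lift hg.isOpen (hg.differentiableAt le_rfl hw) hg.mapsTo hw hx hgw
  have hcomp := (hf.differentiableAt le_rfl hx).hasFDerivAt.comp w hdiff.hasFDerivAt
  have heq : fderiv ℝ g w = (fderiv ℝ f (h w)).comp (fderiv ℝ h w) :=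
    (hcomp.congr_of_eventuallyEq (hev.mono fun s hs => hs.2.symm)).fderiv
  exact ⟨fderiv ℝ h w a, by simp [heq]⟩

/-! ### The second derivative along a leaf -/

/-- The derivative of a field of multiples of `Y` is a combination of `Y` and of its derivative. -/
lemma _root_.HasFDerivAt.exists_of_eventually_smul_eq {E F : Type*} [NormedAddCommGroup E]
    [NormedSpace ℝ E] [NormedAddCommGroup F] [InnerProductSpace ℝ F] {Y G : E → F}
    {Y' G' : E →L[ℝ] F} {w : E} (hY : HasFDerivAt Y Y' w) (hG : HasFDerivAt G G' w)
    (h0 : Y w ≠ 0) (h : ∀ᶠ s in 𝓝 w, ∃ r : ℝ, r • Y s = G s) (a : E) :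
    ∃ c c' : ℝ, G' a = c • Y' a + c' • Y w := by
  -- the coefficient of `G` along `Y`, a quotient of differentiable functions
  let l : E → ℝ := fun s => inner ℝ (Y s) (G s) / inner ℝ (Y s) (Y s)
  have hinner : ∀ s, Y s ≠ 0 → inner ℝ (Y s) (Y s) ≠ 0 :=
    fun s hs => inner_self_ne_zero (𝕜 := ℝ).2 hs
  have hnum : DifferentiableAt ℝ (fun s => (inner ℝ (Y s) (G s) : ℝ)) w :=
    hY.differentiableAt.inner ℝ hG.differentiableAt
  have hden : DifferentiableAt ℝ (fun s => (inner ℝ (Y s) (Y s) : ℝ)) w :=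
    hY.differentiableAt.inner ℝ hY.differentiableAt
  have hl : DifferentiableAt ℝ l w := hnum.mul (hden.inv (hinner w h0))
  have hleq : ∀ᶠ s in 𝓝 w, G s = l s • Y s := by
    filter_upwards [h, hY.continuousAt.eventually_ne h0] with s hs hs0
    obtain ⟨r, hr⟩ := hs
    simp only [l]
    rw [← hr, real_inner_smul_right, mul_div_assoc, div_self (hinner s hs0), mul_one]
  have hder := (hl.hasFDerivAt.fun_smul hY).congr_of_eventuallyEq hleq
  exact ⟨l w, fderiv ℝ l w a, by simp [hG.unique hder]⟩

/-- If `X x = Df ξ` and `DX ξ` is tangent to `M` at `f x`, then so are the second partial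
derivatives at `f x` of any parametrization of a piece of leaf. -/
lemma IsLeafPiece.second_derivative_mem {M : Set (Euc n)} {φ : M → ℙ ℝ (Euc n)} {N : Set (Euc n)}
    (hN : IsLeafPiece φ N) {U : Set (Euc d)} {f X : Euc d → Euc n} (hf : IsLocalParam 1 M U f)
    (hX : ContDiffOn ℝ 1 X U)
    (hφ : ∀ x ∈ U, ∃ (hM : f x ∈ M) (hX : X x ≠ 0),
      φ ⟨f x, hM⟩ = Projectivization.mk ℝ (X x) hX)
    {x : Euc d} (hx : x ∈ U) {ξ : Euc d} (hξ : fderiv ℝ f x ξ = X x)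
    (hT : fderiv ℝ X x ξ ∈ tangentSpace d M (f x))
    {W : Set (Euc 1)} {γ : Euc 1 → Euc n} (hγ : IsLocalParam 2 N W γ) {w : Euc 1} (hw : w ∈ W)
    (hγw : γ w = f x) (a b : Euc 1) :
    fderiv ℝ (fderiv ℝ γ) w a b ∈ tangentSpace d M (f x) := by
  have hγ1 : IsLocalParam 1 N W γ := hγ.of_le (by norm_num)
  have hγdiff := fun s (hs : s ∈ W) => hγ1.differentiableAt le_rfl hs
  obtain ⟨h, rfl, hdiff, hev⟩ :=
    hf.exists_lift hγ.isOpen (hγdiff w hw) (fun s hs => hN.subset (hγ.mapsTo hs)) hw hx hγw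
  -- first derivatives of `γ` are multiples of `X ∘ h`
  have hspan : ∀ s ∈ W, h s ∈ U → f (h s) = γ s → ∀ c, ∃ r : ℝ, r • X (h s) = fderiv ℝ γ s c := by
    intro s hs hsU hsγ c
    obtain ⟨hM, hX0, hφs⟩ := hφ (h s) hsU
    have h1 := hγ1.fderiv_mem_tangentSpace hs c
    rw [hN.tangent _ (hγ.mapsTo hs)] at h1
    have h2 : (⟨γ s, hN.subset (hγ.mapsTo hs)⟩ : M) = ⟨f (h s), hM⟩ := Subtype.ext hsγ.symm
    rw [h2, hφs, Projectivization.submodule_mk] at h1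
    exact Submodule.mem_span_singleton.1 h1
  have hX0 : X (h w) ≠ 0 := (hφ _ hx).2.1
  have hXd : DifferentiableAt ℝ X (h w) :=
    (hX.contDiffAt (hf.isOpen.mem_nhds hx)).differentiableAt one_ne_zero
  have hXh : HasFDerivAt (fun s => X (h s)) ((fderiv ℝ X (h w)).comp (fderiv ℝ h w)) w :=
    hXd.hasFDerivAt.comp w hdiff.hasFDerivAt
  have hγ2 : DifferentiableAt ℝ (fderiv ℝ γ) w :=
    ((hγ.contDiffOn.contDiffAt (hγ.isOpen.mem_nhds hw)).fderiv_right (m := 1)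
      (by norm_num)).differentiableAt one_ne_zero
  have hγb : HasFDerivAt (fun s => fderiv ℝ γ s b) ((fderiv ℝ (fderiv ℝ γ) w).flip b) w := by
    simpa using hγ2.hasFDerivAt.clm_apply (hasFDerivAt_const b w)
  obtain ⟨c, c', heq⟩ := hXh.exists_of_eventually_smul_eq hγb hX0 (by
    filter_upwards [hev, hγ.isOpen.mem_nhds hw] with s hs hsW
    exact hspan s hsW hs.1 hs.2 b) a
  rw [ContinuousLinearMap.flip_apply, ContinuousLinearMap.comp_apply] at heq
  -- the velocity of the lift is a multiple of `ξ`
  obtain ⟨r, hr⟩ := hspan w hw hx hev.self_of_nhds.2 a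
  have hγf : fderiv ℝ γ w = (fderiv ℝ f (h w)).comp (fderiv ℝ h w) :=
    (((hf.differentiableAt le_rfl hx).hasFDerivAt.comp w hdiff.hasFDerivAt).congr_of_eventuallyEq
      (hev.mono fun s hs => hs.2.symm)).fderiv
  have hhw : fderiv ℝ h w a = r • ξ := by
    apply hf.immersion _ hx
    rw [map_smul, hξ, hr, hγf]
    rfl
  rw [heq, hhw, map_smul]
  refine Submodule.add_mem _ (Submodule.smul_mem _ _ (Submodule.smul_mem _ _ hT))
    (Submodule.smul_mem _ _ ?_)
  rw [← hξ]
  exact hf.fderiv_mem_tangentSpace hx ξ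

/-! ### The ruled map -/

/-- A semi-generic bundle has a local section `X` over a parametrization `f` for which
`(x, t) ↦ f x + t • X x` is an immersion at some point. -/
lemma IsSemiGeneric.exists_injective {M : Set (Euc n)} {φ : M → ℙ ℝ (Euc n)}
    (hφ : IsC1LineBundle d φ) (hsg : IsSemiGeneric d φ) :
    ∃ (U : Set (Euc d)) (f X : Euc d → Euc n), IsLocalParam 1 M U f ∧ ContDiffOn ℝ 1 X U ∧
      (∀ x ∈ U, ∃ (hM : f x ∈ M) (hX : X x ≠ 0),
        φ ⟨f x, hM⟩ = Projectivization.mk ℝ (X x) hX) ∧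
      ∃ x ∈ U, ∃ t : ℝ, Function.Injective ((fderiv ℝ f x + t • fderiv ℝ X x).coprod
        (ContinuousLinearMap.toSpanSingleton ℝ (X x))) := by
  obtain hnt | ⟨ht, hno⟩ := hsg
  · simp only [IsTangent, not_forall] at hnt
    obtain ⟨⟨p, hp⟩, hpt⟩ := hnt
    obtain ⟨U, f, X, hf, ⟨x, hx, rfl⟩, hX, hXφ⟩ := hφ p hp
    refine ⟨U, f, X, hf, hX, hXφ, x, hx, 0, ?_⟩
    suffices h : ∀ v, fderiv ℝ f x v ≠ X x by
      have h0 : fderiv ℝ f x + (0 : ℝ) • fderiv ℝ X x = fderiv ℝ f x := by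
        ext1 v
        simp
      rw [h0]
      exact injective_coprod_toSpanSingleton (hf.immersion x hx) h
    refine fun v hv => hpt ?_
    obtain ⟨_, _, hφx⟩ := hXφ x hx
    rw [hφx, Projectivization.submodule_mk, Submodule.span_singleton_le_iff_mem, ← hv]
    exact hf.fderiv_mem_tangentSpace hx v
  · simp only [Osculates, OsculatesAt, not_forall] at hno
    obtain ⟨⟨p, hp⟩, N, hN, hpN, hle⟩ := hno
    obtain ⟨U, f, X, hf, ⟨x, hx, rfl⟩, hX, hXφ⟩ := hφ p hp
    refine ⟨U, f, X, hf, hX, hXφ, x, hx, ?_⟩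
    obtain ⟨ξ, hξ⟩ : ∃ ξ, fderiv ℝ f x ξ = X x := by
      apply hf.exists_fderiv_eq hx
      obtain ⟨hM, _, hφx⟩ := hXφ x hx
      apply ht ⟨f x, hM⟩
      rw [hφx, Projectivization.submodule_mk]
      exact Submodule.mem_span_singleton_self _
    rw [← hξ]
    refine exists_injective_pencil _ _ (hf.immersion x hx) ξ fun v hv => hle ?_
    refine Submodule.span_le.2 ?_
    rintro _ ⟨W, γ, w, hγ, hw, hγw, ⟨a, rfl⟩ | ⟨a, b, rfl⟩⟩
    · have h1 := (hγ.of_le (show (1 : WithTop ℕ∞) ≤ 2 by norm_num)).fderiv_mem_tangentSpace hw a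
      rw [hγw, hN.tangent _ hpN] at h1
      exact ht _ h1
    · exact hN.second_derivative_mem hf hX hXφ hx hξ (hv ▸ hf.fderiv_mem_tangentSpace hx v)
        hγ hw hγw a b

end EmbeddedBundle

theorem theorem4p9 {n d : ℕ} (hd : 1 ≤ d) (hdn : d < n)
    (M : Set (EmbeddedBundle.Euc n)) (hM : EmbeddedBundle.IsSubmanifold 1 d M)
    (φ : M → ℙ ℝ (EmbeddedBundle.Euc n)) (hφ : EmbeddedBundle.IsC1LineBundle d φ)
    (hsg : EmbeddedBundle.IsSemiGeneric d φ) :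
    0 < μH[(d : ℝ) + 1] (EmbeddedBundle.codiagonal n '' EmbeddedBundle.totalSpace φ) ∧
      (d + 1 = n →
        (interior (EmbeddedBundle.codiagonal n '' EmbeddedBundle.totalSpace φ)).Nonempty) := by
  obtain ⟨U, f, X, hf, hX, hXφ, x, hx, t, hinj⟩ := hsg.exists_injective hφ
  let F : EmbeddedBundle.Euc d × ℝ → EmbeddedBundle.Euc n := fun z => f z.1 + z.2 • X z.1
  have hU : U ∈ 𝓝 x := hf.isOpen.mem_nhds hx
  have hsub : F '' (Prod.fst ⁻¹' U) ⊆
      EmbeddedBundle.codiagonal n '' EmbeddedBundle.totalSpace φ := by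
    rintro _ ⟨⟨y, s⟩, hy, rfl⟩
    obtain ⟨hM, hX0, hφy⟩ := hXφ y hy
    refine ⟨(f y, s • X y), ⟨⟨f y, hM⟩, rfl, ?_⟩, by simp [EmbeddedBundle.codiagonal, F]⟩
    rw [hφy, Projectivization.submodule_mk]
    exact Submodule.smul_mem _ _ (Submodule.mem_span_singleton_self _)
  have hs : Prod.fst ⁻¹' U ∈ 𝓝 (x, t) := continuousAt_fst.preimage_mem_nhds hU
  have hfst : HasStrictFDerivAt (fun z : EmbeddedBundle.Euc d × ℝ => z.1)
      (ContinuousLinearMap.fst ℝ _ ℝ) (x, t) := hasStrictFDerivAt_fst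
  have hfx : HasStrictFDerivAt f (fderiv ℝ f x) x :=
    (hf.contDiffOn.contDiffAt hU).hasStrictFDerivAt one_ne_zero
  have hXx : HasStrictFDerivAt X (fderiv ℝ X x) x :=
    (hX.contDiffAt hU).hasStrictFDerivAt one_ne_zero
  have hF : HasStrictFDerivAt F ((fderiv ℝ f x + t • fderiv ℝ X x).coprod
      (ContinuousLinearMap.toSpanSingleton ℝ (X x))) (x, t) := by
    have h := (HasStrictFDerivAt.comp (x, t) (g := f) hfx hfst).add
      (HasStrictFDerivAt.smul (hasStrictFDerivAt_snd (p := (x, t)))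
        (HasStrictFDerivAt.comp (x, t) (g := X) hXx hfst))
    refine h.congr_fderiv ?_
    ext v <;> simp
  constructor
  · have hpos := EmbeddedBundle.hausdorffMeasure_pos_of_injective_fderiv (m := d + 1) (by simp)
      hF hinj hs
    push_cast at hpos
    exact hpos.trans_le (measure_mono hsub)
  · intro hdn1
    exact (EmbeddedBundle.interior_image_nonempty_of_injective_fderiv (by simpa using hdn1)
      hF hinj hs).mono (interior_mono hsub)
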